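/- Definitions. A random ordering of a finite or countably infinite graph $\Gamma$ is a probability distribution $\mathbb{P}$ on the set of total orderings of $V(\Gamma)$, equipped with the $\sigma$-algebra generated by the events $u<v$ ($u,v\in V(\Gamma)$). It is consistent if $\mathbb{P}(v_1<\dots<v_k)=\mathbb{P}(\phi(v_1)<\dots<\phi(v_k))$ for every isomorphism $\phi\colon H_1\to H_2$ between finite induced subgraphs $H_1,H_2$ of $\Gamma$ and all $v_1,\dots,v_k\in V(H_1)$. The uniform random ordering is the one given by the order of i.i.d. random variables $X_v$, $v\in V(\Gamma)$, uniform on $[0,1]$; $\Gamma$ is uniform if this is the only consistent random ordering of $\Gamma$. A template $G$ is a finite graph each of whose vertices is labelled either full or empty. Its infinite blow-up $G_\infty$ is obtained by replacing each vertex $v$ by an infinite set $W_v=\{v_1,v_2,\dots\}$ that induces a complete graph if $v$ is full and an edgeless graph if $v$ is empty, where for distinct $v,w$ and all $i,j\ge 1$ the pair $v_iw_j$ is an edge of $G_\infty$ if and only if $vw$ is an edge of $G$. The template $G$ is uniform if $G_\infty$ is uniform. It is reduced if it contains no two adjacent full vertices that are twins and no two non-adjacent empty vertices that are twins, where distinct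 vertices $u,v$ are twins if they have the same neighbours in $V(G)\setminus\{u,v\}$. Theorem. If $G$ is a non-uniform reduced template, then either $G$ is an edgeless graph with at most one empty vertex, or $G$ is a complete graph with at most one full vertex. Moreover, for every non-uniform template $G$ (reduced or not), the infinite blow-up $G_\infty$ is a disjoint union of cliques or a complete multipartite graph. -/

import Mathlib

open MeasureTheory

/-- The total orderings of a set `V`, given as strict total order relations `r u v` ("`u < v`"). -/
def TotalOrdering (V : Type*) : Type _ :=
  {r : V → V → Prop // IsStrictTotalOrder V r}

namespace TotalOrdering

/-- `r.lt u v` means that `u` precedes `v` in the ordering `r`. -/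
def lt {V : Type*} (r : TotalOrdering V) (u v : V) : Prop := r.1 u v

/-- The σ-algebra generated by all events of the form `u < v`. -/
instance (V : Type*) : MeasurableSpace (TotalOrdering V) :=
  MeasurableSpace.generateFrom {A | ∃ u v : V, A = {r : TotalOrdering V | r.lt u v}}

/-- The event `v₁ < v₂ < ⋯ < v_k`. -/
def chainEvent {V : Type*} {k : ℕ} (v : Fin k → V) : Set (TotalOrdering V) :=
  {r | ∀ i j : Fin k, i < j → r.lt (v i) (v j)}

/-- The ordering of `V` by the values of `X : V → [0,1]`. Ties (which have probability zero for
independent uniform values on countably many vertices) are broken by a fixed well-ordering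
of `V`, so that a total ordering is obtained for every `X`. -/
def ofValues {V : Type*} (X : V → unitInterval) : TotalOrdering V :=
  ⟨fun u v => X u < X v ∨ (X u = X v ∧ WellOrderingRel u v),
    { irrefl := by
        rintro u (h | ⟨_, h⟩)
        · exact lt_irrefl _ h
        · exact irrefl_of WellOrderingRel u h
      trans := by
        rintro u v w (h | ⟨h, h'⟩) (g | ⟨g, g'⟩)
        · exact Or.inl (h.trans g)
        · exact Or.inl (g ▸ h)
        · exact Or.inl (h ▸ g)
        · exact Or.inr ⟨h.trans g, trans_of WellOrderingRel h' g'⟩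
      trichotomous := by
        intro u v h1 h2
        push Not at h1 h2
        have hX : X u = X v := le_antisymm h2.1 h1.1
        rcases trichotomous_of WellOrderingRel u v with h | h | h
        · exact absurd h (h1.2 hX)
        · exact h
        · exact absurd h (h2.2 hX.symm) }⟩

theorem measurable_ofValues {V : Type*} :
    Measurable (ofValues : (V → unitInterval) → TotalOrdering V) := by
  refine measurable_generateFrom ?_
  rintro _ ⟨u, v, rfl⟩
  have h1 : MeasurableSet {X : V → unitInterval | X u < X v} :=
    measurableSet_lt (measurable_pi_apply u) (measurable_pi_apply v)
  have h2 : MeasurableSet {X : V → unitInterval | X u = X v ∧ WellOrderingRel u v} :=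
    (measurableSet_eq_fun (measurable_pi_apply u) (measurable_pi_apply v)).inter
      (MeasurableSet.const _)
  exact h1.union h2

/-- The uniform random ordering of `V`: the law of the ordering by i.i.d. random variables
`X_v`, `v ∈ V`, with the uniform distribution on `[0,1]`. -/
noncomputable def uniformLaw (V : Type*) : Measure (TotalOrdering V) :=
  (Measure.infinitePi (fun _ : V => (volume : Measure unitInterval))).map ofValues

instance (V : Type*) : IsProbabilityMeasure (uniformLaw V) :=
  Measure.isProbabilityMeasure_map measurable_ofValues.aemeasurable

end TotalOrdering

namespace SimpleGraph

/-- A distribution `μ` on the total orderings of `V(G)` is consistent if any isomorphism between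
two finite induced subgraphs of `G` maps the law of the induced order on the first one
to the law of the induced order on the second one. -/
def IsConsistentOrder {V : Type*} (G : SimpleGraph V) (μ : Measure (TotalOrdering V)) : Prop :=
  ∀ (S T : Set V), S.Finite → T.Finite → ∀ φ : G.induce S ≃g G.induce T,
    ∀ (k : ℕ) (v : Fin k → S),
      μ (TotalOrdering.chainEvent fun i => (v i : V)) =
        μ (TotalOrdering.chainEvent fun i => (φ (v i) : V))

/-- `G` is uniform if the only consistent random ordering on `G` is the uniform one. -/
def IsOrderUniform {V : Type*} (G : SimpleGraph V) : Prop :=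
  ∀ μ : Measure (TotalOrdering V), IsProbabilityMeasure μ → G.IsConsistentOrder μ →
    μ = TotalOrdering.uniformLaw V

/-- `G` is a disjoint union of cliques: `V(G)` is partitioned into classes, and two distinct
vertices are adjacent if and only if they are in the same class. -/
def IsDisjointUnionOfCliques {V : Type*} (G : SimpleGraph V) : Prop :=
  ∃ s : Setoid V, ∀ u v : V, G.Adj u v ↔ u ≠ v ∧ s u v

/-- Two distinct vertices are twins if their neighbourhoods outside `{u, v}` agree. -/
def AreTwins {V : Type*} (G : SimpleGraph V) (u v : V) : Prop :=
  u ≠ v ∧ G.neighborSet u \ {u, v} = G.neighborSet v \ {u, v}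

end SimpleGraph

/-- A template: a graph each of whose vertices is labelled either full or empty (not full). -/
structure Template (V : Type*) where
  graph : SimpleGraph V
  full : Set V

namespace Template

/-- The set of empty vertices. -/
def empty {V : Type*} (G : Template V) : Set V := G.fullᶜ

/-- The infinite blow-up: each vertex `v` is replaced by infinitely many vertices `(v, i)`,
inducing a complete graph if `v` is full and an edgeless graph if `v` is empty. -/
def blowUp {V : Type*} (G : Template V) : SimpleGraph (V × ℕ) where
  Adj x y := (x.1 = y.1 ∧ x.1 ∈ G.full ∧ x.2 ≠ y.2) ∨ G.graph.Adj x.1 y.1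
  symm := ⟨by
    rintro x y (⟨h, hf, hn⟩ | h)
    · exact Or.inl ⟨h.symm, h ▸ hf, hn.symm⟩
    · exact Or.inr h.symm⟩
  loopless := ⟨by
    rintro x (⟨_, _, hn⟩ | h)
    · exact hn rfl
    · exact G.graph.irrefl h⟩

/-- A template is uniform if its infinite blow-up is. -/
def IsUniform {V : Type*} (G : Template V) : Prop := G.blowUp.IsOrderUniform

/-- A template is reduced if it has no adjacent full twins and no non-adjacent empty twins. -/
def IsReduced {V : Type*} (G : Template V) : Prop :=
  ∀ u v : V, G.graph.AreTwins u v →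
    ¬ (u ∈ G.full ∧ v ∈ G.full ∧ G.graph.Adj u v) ∧
    ¬ (u ∈ G.empty ∧ v ∈ G.empty ∧ ¬ G.graph.Adj u v)

end Template

/-! Let `μ` be a consistent law on the orderings of the blow-up. By symmetry, the probability that a
given vertex of a triple is its maximum depends only on two numbers: `p`, for the centre of an
induced path, and `q`, for the isolated vertex of an edge plus a vertex
(`exists_maxProb_eq_tripleValue`).

Fix a vertex `w` and compare infinitely many copies `u_i` of `u` and `v_i` of `v` below `w`. The
average of `1_{u_i < w} - 1_{v_i < w}` has second moment tending to `α - 2γ + β`, a combination of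
triple probabilities. So this is nonnegative, and if it is zero, every event correlates equally with
`u_i < w` and `v_i < w`. Applied to few parts at a time, these constraints force `p = q = 1/3`
unless adjacency of parts, with full vertices looped, or its complement is transitive
(`isTrans_or_isTrans_not`).

If `p = q = 1/3`, the second moment vanishes for all `u`, `v`, `w`. Any vertex of a chain event can
then be exchanged for any other, so all chains of length `k` have probability `1/k!` and `μ` is
uniform (`eq_uniformLaw_of_maxProb_eq`). Hence non-uniformity gives one of the two transitivities,
from which both conclusions are read off. -/

namespace TotalOrdering

/-! ### Events determined by the order of finitely many vertices. -/

section Patterns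

variable {V : Type*} {k : ℕ}

theorem lt_irrefl (r : TotalOrdering V) (a : V) : ¬ r.lt a a := r.2.irrefl a

theorem lt_trans (r : TotalOrdering V) {a b c : V} (h : r.lt a b) (h' : r.lt b c) : r.lt a c :=
  r.2.trans _ _ _ h h'

theorem lt_asymm (r : TotalOrdering V) {a b : V} (h : r.lt a b) : ¬ r.lt b a :=
  fun h' => r.lt_irrefl _ (r.lt_trans h h')

theorem lt_or_gt (r : TotalOrdering V) {a b : V} (h : a ≠ b) : r.lt a b ∨ r.lt b a := by
  by_contra! h'
  exact h (r.2.trichotomous _ _ h'.1 h'.2)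

theorem measurableSet_lt (a b : V) : MeasurableSet {r : TotalOrdering V | r.lt a b} :=
  MeasurableSpace.measurableSet_generateFrom ⟨a, b, rfl⟩

/-- An event which depends only on the relative order of the vertices `x i`. -/
def patternEvent (x : Fin k → V) (P : (Fin k → Fin k → Prop) → Prop) : Set (TotalOrdering V) :=
  {r | P fun i j => r.lt (x i) (x j)}

theorem measurableSet_patternEvent (x : Fin k → V) (P : (Fin k → Fin k → Prop) → Prop) :
    MeasurableSet (patternEvent x P) := by
  have h : Measurable fun (r : TotalOrdering V) (i j : Fin k) => r.lt (x i) (x j) := by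
    refine measurable_pi_iff.2 fun i => measurable_pi_iff.2 fun j => ?_
    exact measurable_to_prop (by simpa [Set.preimage] using measurableSet_lt (x i) (x j))
  exact h (MeasurableSet.of_discrete (s := {f | P f}))

theorem measurableSet_chainEvent (x : Fin k → V) : MeasurableSet (chainEvent x) :=
  measurableSet_patternEvent x fun f => ∀ i j, i < j → f i j

theorem lt_iff_of_mem_chainEvent {x : Fin k → V} {σ : Equiv.Perm (Fin k)} {r : TotalOrdering V}
    (h : r ∈ chainEvent (x ∘ σ)) (i j : Fin k) : r.lt (x i) (x j) ↔ σ.symm i < σ.symm j := by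
  have key : ∀ i j, σ.symm i < σ.symm j → r.lt (x i) (x j) := fun i j hij => by
    simpa using h _ _ hij
  refine ⟨fun hr => ?_, key i j⟩
  rcases lt_trichotomy (σ.symm i) (σ.symm j) with h' | h' | h'
  · exact h'
  · exact absurd hr (by rw [σ.symm.injective h']; exact r.lt_irrefl _)
  · exact absurd hr (r.lt_asymm (key _ _ h'))

theorem exists_mem_chainEvent {x : Fin k → V} (hx : Function.Injective x) (r : TotalOrdering V) :
    ∃ σ : Equiv.Perm (Fin k), r ∈ chainEvent (x ∘ σ) := by
  classical
  have := r.2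
  let _ : LinearOrder V := linearOrderOfSTO r.1
  refine ⟨Tuple.sort x, fun i j hij => ?_⟩
  exact (Tuple.monotone_sort x).strictMono_of_injective
    (hx.comp (Tuple.sort x).injective) hij

theorem pairwise_disjoint_chainEvent (x : Fin k → V) :
    Pairwise fun σ τ : Equiv.Perm (Fin k) =>
      Disjoint (chainEvent (x ∘ σ)) (chainEvent (x ∘ τ)) := by
  intro σ τ hne
  refine Set.disjoint_left.2 fun r hσ hτ => hne ?_
  have h : StrictMono (τ.symm ∘ σ) := fun i j hij => by
    have := (lt_iff_of_mem_chainEvent hσ (σ i) (σ j)).2 (by simpa using hij)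
    exact (lt_iff_of_mem_chainEvent hτ _ _).1 this
  have h' : (τ.symm ∘ σ : Fin k → Fin k) = id :=
    (h.range_inj strictMono_id).1
      (by rw [(τ.symm.surjective.comp σ.surjective).range_eq, Set.range_id])
  ext i
  have := congrArg τ (congrFun h' i)
  simpa using congrArg Fin.val this

theorem sum_measure_inter_chainEvent (μ : Measure (TotalOrdering V)) {x : Fin k → V}
    (hx : Function.Injective x) (B : Set (TotalOrdering V)) (hB : MeasurableSet B) :
    ∑ σ : Equiv.Perm (Fin k), μ (B ∩ chainEvent (x ∘ σ)) = μ B := by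
  rw [← tsum_fintype (L := .unconditional _), ← measure_iUnion, ← Set.inter_iUnion]
  · congr 1
    refine Set.inter_eq_left.2 fun r _ => ?_
    exact Set.mem_iUnion.2 (exists_mem_chainEvent hx r)
  · exact fun σ τ h => (pairwise_disjoint_chainEvent x h).mono Set.inter_subset_right
      Set.inter_subset_right
  · exact fun σ => hB.inter (measurableSet_chainEvent _)

/-- The `k!` chain events of a tuple partition the space, and a pattern event contains or misses
each of them entirely. -/
theorem measure_patternEvent_congr {μ ν : Measure (TotalOrdering V)} {x y : Fin k → V}
    (hx : Function.Injective x) (hy : Function.Injective y)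
    (h : ∀ σ : Equiv.Perm (Fin k), μ (chainEvent (x ∘ σ)) = ν (chainEvent (y ∘ σ)))
    (P : (Fin k → Fin k → Prop) → Prop) : μ (patternEvent x P) = ν (patternEvent y P) := by
  rw [← sum_measure_inter_chainEvent μ hx _ (measurableSet_patternEvent x P),
    ← sum_measure_inter_chainEvent ν hy _ (measurableSet_patternEvent y P)]
  refine Finset.sum_congr rfl fun σ _ => ?_
  have key : ∀ z : Fin k → V, patternEvent z P ∩ chainEvent (z ∘ σ) =
      {r | r ∈ chainEvent (z ∘ σ) ∧ P fun i j => σ.symm i < σ.symm j} := by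
    intro z
    ext r
    simp only [Set.mem_inter_iff, Set.mem_ofPred_eq, patternEvent, and_comm (b := r ∈ chainEvent _)]
    refine and_congr_right fun hr => ?_
    simp only [lt_iff_of_mem_chainEvent hr]
  rw [key, key]
  by_cases hP : P fun i j => σ.symm i < σ.symm j <;> simp [hP, h]

/-- Two laws which agree on all chain events are equal. -/
theorem measure_ext_of_chainEvent {μ ν : Measure (TotalOrdering V)} [IsProbabilityMeasure μ]
    [IsProbabilityMeasure ν]
    (h : ∀ (k : ℕ) (x : Fin k → V), Function.Injective x →
      μ (chainEvent x) = ν (chainEvent x)) : μ = ν := by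
  classical
  -- The π-system of events that depend on the order of a finite set of vertices only.
  let C : Set (Set (TotalOrdering V)) := {B | ∃ S : Finset V, ∀ r r' : TotalOrdering V,
    (∀ a ∈ S, ∀ b ∈ S, (r.lt a b ↔ r'.lt a b)) → (r ∈ B ↔ r' ∈ B)}
  have hC : ∀ B ∈ C, ∃ (k : ℕ) (x : Fin k → V) (P : (Fin k → Fin k → Prop) → Prop),
      Function.Injective x ∧ B = patternEvent x P := by
    rintro B ⟨S, hS⟩
    let x : Fin S.card → V := fun i => (S.equivFin.symm i : V)
    refine ⟨S.card, x, fun f => ∃ r ∈ B, f = fun i j => r.lt (x i) (x j),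
      Subtype.val_injective.comp S.equivFin.symm.injective, ?_⟩
    ext r
    refine ⟨fun hr => ⟨r, hr, rfl⟩, ?_⟩
    rintro ⟨r', hr', hrr'⟩
    refine (hS r r' fun a ha b hb => ?_).2 hr'
    have := congrFun (congrFun hrr' (S.equivFin ⟨a, ha⟩)) (S.equivFin ⟨b, hb⟩)
    simpa [x] using this
  refine ext_of_generate_finite C ?_ ?_ ?_ (by simp)
  · refine le_antisymm (MeasurableSpace.generateFrom_le ?_) (MeasurableSpace.generateFrom_le ?_)
    · rintro _ ⟨u, v, rfl⟩
      refine MeasurableSpace.measurableSet_generateFrom ⟨{u, v}, fun r r' hr => ?_⟩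
      exact hr u (by simp) v (by simp)
    · intro B hB
      obtain ⟨k, x, P, -, rfl⟩ := hC B hB
      exact measurableSet_patternEvent x P
  · rintro A ⟨S, hS⟩ B ⟨T, hT⟩ -
    refine ⟨S ∪ T, fun r r' hr => and_congr (hS r r' ?_) (hT r r' ?_)⟩
    · exact fun a ha b hb => hr a (Finset.mem_union_left _ ha) b (Finset.mem_union_left _ hb)
    · exact fun a ha b hb => hr a (Finset.mem_union_right _ ha) b (Finset.mem_union_right _ hb)
  · intro B hB
    obtain ⟨k, x, P, hx, rfl⟩ := hC B hB
    exact measure_patternEvent_congr hx hx (fun σ => h k _ (hx.comp σ.injective)) P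

theorem measure_chainEvent_of_perm_invariant (μ : Measure (TotalOrdering V))
    [IsProbabilityMeasure μ] {x : Fin k → V} (hx : Function.Injective x)
    (h : ∀ σ : Equiv.Perm (Fin k), μ (chainEvent (x ∘ σ)) = μ (chainEvent x)) :
    μ (chainEvent x) = (k.factorial : ENNReal)⁻¹ := by
  have := sum_measure_inter_chainEvent μ hx _ MeasurableSet.univ
  simp only [Set.univ_inter, h, Finset.sum_const, Finset.card_univ, Fintype.card_perm,
    Fintype.card_fin, nsmul_eq_mul, measure_univ] at this
  exact ENNReal.eq_inv_of_mul_eq_one_left (by rwa [mul_comm])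

end Patterns

/-! ### Symmetry of the uniform ordering. -/

section Uniform

variable {V : Type*}

theorem infinitePi_eval_eq_null {a b : V} (h : a ≠ b) :
    Measure.infinitePi (fun _ : V => (volume : Measure unitInterval)) {X | X a = X b} = 0 := by
  have h1 := Measure.infinitePi_map_eval_prod
    (P := fun _ : V => (volume : Measure unitInterval)) h
  have h2 : MeasurableSet {p : unitInterval × unitInterval | p.1 = p.2} :=
    measurableSet_eq_fun measurable_fst measurable_snd
  have h3 : ((volume : Measure unitInterval).prod volume) {p | p.1 = p.2} = 0 := by
    rw [Measure.measure_prod_null h2]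
    refine Filter.Eventually.of_forall fun t => ?_
    have : Prod.mk t ⁻¹' {p : unitInterval × unitInterval | p.1 = p.2} = {t} := by
      ext s; simp [eq_comm]
    simp [this]
  rw [← h1, Measure.map_apply (by fun_prop) h2] at h3
  exact h3

/-- The values at `k` distinct vertices have the same product law whichever vertices are taken, and
ties are null. -/
theorem uniformLaw_chainEvent_eq {k : ℕ} {x y : Fin k → V} (hx : Function.Injective x)
    (hy : Function.Injective y) :
    uniformLaw V (chainEvent x) = uniformLaw V (chainEvent y) := by
  have key : ∀ z : Fin k → V, Function.Injective z → uniformLaw V (chainEvent z) =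
      Measure.infinitePi (fun _ : Fin k => (volume : Measure unitInterval))
        {t | ∀ i j, i < j → t i < t j} := by
    intro z hz
    have hm : MeasurableSet {t : Fin k → unitInterval | ∀ i j, i < j → t i < t j} := by
      simp only [Set.ofPred_forall]
      exact MeasurableSet.iInter fun i => MeasurableSet.iInter fun j => MeasurableSet.iInter
        fun _ => _root_.measurableSet_lt (measurable_pi_apply i) (measurable_pi_apply j)
    rw [← Measure.map_infinitePi_infinitePi_of_inj
      (P := fun _ : V => (volume : Measure unitInterval)) hz,
      Measure.map_apply (by fun_prop) hm, uniformLaw,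
      Measure.map_apply measurable_ofValues (measurableSet_chainEvent z)]
    refine measure_congr ?_
    have hne : ∀ᵐ X ∂Measure.infinitePi (fun _ : V => (volume : Measure unitInterval)),
        ∀ i j, i < j → X (z i) ≠ X (z j) := by
      simp only [ae_all_iff]
      intro i j hij
      exact measure_eq_zero_iff_ae_notMem.1 (infinitePi_eval_eq_null (hz.ne hij.ne))
    filter_upwards [hne] with X hX
    refine propext (forall₃_congr fun i j hij => ?_)
    simp [lt, ofValues, hX i j hij]
  rw [key x hx, key y hy]

end Uniform

end TotalOrdering

/-! ### Second moment inequality for two sequences of events. -/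

section SecondMoment

variable {Ω : Type*} [MeasurableSpace Ω]

/-- The right-hand side bounds the expectation of `(∑ i < n, (1_{U i} - 1_{V i}) - t 1_A)²` from
above. Only off-diagonal correlations are prescribed, so that `U` and `V` may coincide. -/
theorem integral_sq_sum_indicator_sub {μ : Measure Ω} [IsProbabilityMeasure μ] {U V : ℕ → Set Ω}
    (hU : ∀ i, MeasurableSet (U i)) (hV : ∀ i, MeasurableSet (V i)) {α β γ : ℝ}
    (hα : ∀ i j, i ≠ j → μ.real (U i ∩ U j) = α) (hβ : ∀ i j, i ≠ j → μ.real (V i ∩ V j) = β)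
    (hγ : ∀ i j, i ≠ j → μ.real (U i ∩ V j) = γ) {A : Set Ω} (hA : MeasurableSet A) {a b : ℝ}
    (ha : ∀ i, μ.real (A ∩ U i) = a) (hb : ∀ i, μ.real (A ∩ V i) = b) (n : ℕ) (t : ℝ) :
    0 ≤ (n * n - n) * (α - 2 * γ + β) + 2 * n - 2 * t * n * (a - b) + t ^ 2 := by
  have hint : ∀ S T : Set Ω, MeasurableSet S → MeasurableSet T →
      Integrable (fun ω => S.indicator (1 : Ω → ℝ) ω * T.indicator (1 : Ω → ℝ) ω) μ ∧
      ∫ ω, S.indicator (1 : Ω → ℝ) ω * T.indicator (1 : Ω → ℝ) ω ∂μ = μ.real (S ∩ T) := by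
    intro S T hS hT
    have : (fun ω => S.indicator (1 : Ω → ℝ) ω * T.indicator (1 : Ω → ℝ) ω) =
        (S ∩ T).indicator 1 := by
      ext ω; rw [Set.inter_indicator_one]; rfl
    rw [this]
    exact ⟨(integrable_const (1 : ℝ)).indicator (hS.inter hT),
      integral_indicator_one (hS.inter hT)⟩
  let u : ℕ → Ω → ℝ := fun i => (U i).indicator 1
  let v : ℕ → Ω → ℝ := fun i => (V i).indicator 1
  let c : Ω → ℝ := A.indicator 1
  have h0 : 0 ≤ ∫ ω, (∑ i ∈ Finset.range n, (u i ω - v i ω) - t * c ω) ^ 2 ∂μ :=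
    integral_nonneg fun ω => sq_nonneg _
  have hexp : ∀ ω, (∑ i ∈ Finset.range n, (u i ω - v i ω) - t * c ω) ^ 2 =
      (∑ i ∈ Finset.range n, ∑ j ∈ Finset.range n,
        (u i ω * u j ω - u i ω * v j ω - u j ω * v i ω + v i ω * v j ω)) -
      2 * t * (∑ i ∈ Finset.range n, (c ω * u i ω - c ω * v i ω)) + t ^ 2 * (c ω * c ω) := by
    intro ω
    rw [sub_sq, sq, Finset.sum_mul_sum]
    have e1 : ∑ i ∈ Finset.range n, (c ω * u i ω - c ω * v i ω) =
        c ω * ∑ i ∈ Finset.range n, (u i ω - v i ω) := by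
      rw [Finset.mul_sum]; exact Finset.sum_congr rfl fun i _ => by ring
    have e2 : ∑ i ∈ Finset.range n, ∑ j ∈ Finset.range n, (u i ω - v i ω) * (u j ω - v j ω) =
        ∑ i ∈ Finset.range n, ∑ j ∈ Finset.range n,
          (u i ω * u j ω - u i ω * v j ω - u j ω * v i ω + v i ω * v j ω) :=
      Finset.sum_congr rfl fun i _ => Finset.sum_congr rfl fun j _ => by ring
    rw [e1, e2]; ring
  have hI1 : ∀ i j, Integrable (fun ω =>
      u i ω * u j ω - u i ω * v j ω - u j ω * v i ω + v i ω * v j ω) μ := fun i j =>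
    (((hint _ _ (hU i) (hU j)).1.sub (hint _ _ (hU i) (hV j)).1).sub
      (hint _ _ (hU j) (hV i)).1).add (hint _ _ (hV i) (hV j)).1
  have hI1' : ∀ i j, ∫ ω, (u i ω * u j ω - u i ω * v j ω - u j ω * v i ω + v i ω * v j ω) ∂μ =
      μ.real (U i ∩ U j) - μ.real (U i ∩ V j) - μ.real (U j ∩ V i) + μ.real (V i ∩ V j) := by
    intro i j
    have i1 : Integrable (fun ω => u i ω * u j ω - u i ω * v j ω) μ :=
      (hint _ _ (hU i) (hU j)).1.sub (hint _ _ (hU i) (hV j)).1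
    have i2 : Integrable (fun ω => u i ω * u j ω - u i ω * v j ω - u j ω * v i ω) μ :=
      i1.sub (hint _ _ (hU j) (hV i)).1
    rw [integral_add i2 (hint _ _ (hV i) (hV j)).1, integral_sub i1 (hint _ _ (hU j) (hV i)).1,
      integral_sub (hint _ _ (hU i) (hU j)).1 (hint _ _ (hU i) (hV j)).1,
      (hint _ _ (hU i) (hU j)).2, (hint _ _ (hU i) (hV j)).2, (hint _ _ (hU j) (hV i)).2,
      (hint _ _ (hV i) (hV j)).2]
  have hI2 : ∀ i, Integrable (fun ω => c ω * u i ω - c ω * v i ω) μ := fun i =>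
    (hint _ _ hA (hU i)).1.sub (hint _ _ hA (hV i)).1
  have hI2' : ∀ i, ∫ ω, (c ω * u i ω - c ω * v i ω) ∂μ = a - b := fun i => by
    rw [integral_sub (hint _ _ hA (hU i)).1 (hint _ _ hA (hV i)).1, (hint _ _ hA (hU i)).2,
      (hint _ _ hA (hV i)).2, ha, hb]
  have hI1s : Integrable (fun ω => ∑ i ∈ Finset.range n, ∑ j ∈ Finset.range n,
      (u i ω * u j ω - u i ω * v j ω - u j ω * v i ω + v i ω * v j ω)) μ :=
    integrable_finsetSum _ fun i _ => integrable_finsetSum _ fun j _ => hI1 i j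
  have hI2s : Integrable (fun ω =>
      2 * t * ∑ i ∈ Finset.range n, (c ω * u i ω - c ω * v i ω)) μ :=
    (integrable_finsetSum _ fun i _ => hI2 i).const_mul _
  have hI3 : Integrable (fun ω => (∑ i ∈ Finset.range n, ∑ j ∈ Finset.range n,
      (u i ω * u j ω - u i ω * v j ω - u j ω * v i ω + v i ω * v j ω)) -
      2 * t * ∑ i ∈ Finset.range n, (c ω * u i ω - c ω * v i ω)) μ := hI1s.sub hI2s
  simp_rw [hexp] at h0
  rw [integral_add hI3 ((hint _ _ hA hA).1.const_mul _), integral_sub hI1s hI2s,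
    integral_const_mul, integral_const_mul, (hint _ _ hA hA).2,
    integral_finsetSum _ fun i _ => integrable_finsetSum _ fun j _ => hI1 i j,
    integral_finsetSum _ fun i _ => hI2 i] at h0
  simp_rw [integral_finsetSum _ fun j _ => hI1 _ j, hI1', hI2'] at h0
  -- The diagonal term is at most 2; the other `n - 1` terms equal `α - 2γ + β`.
  have hb1 : ∀ i ∈ Finset.range n, ∑ j ∈ Finset.range n,
      (μ.real (U i ∩ U j) - μ.real (U i ∩ V j) - μ.real (U j ∩ V i) + μ.real (V i ∩ V j)) ≤
      (n - 1) * (α - 2 * γ + β) + 2 := by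
    intro i hi
    rw [← Finset.add_sum_erase _ _ hi]
    have e : ∀ j ∈ (Finset.range n).erase i,
        (μ.real (U i ∩ U j) - μ.real (U i ∩ V j) - μ.real (U j ∩ V i) + μ.real (V i ∩ V j)) =
        α - 2 * γ + β := by
      intro j hj
      have hij : i ≠ j := (Finset.ne_of_mem_erase hj).symm
      rw [hα _ _ hij, hβ _ _ hij, hγ _ _ hij, hγ _ _ hij.symm]; ring
    have hn : 1 ≤ n := by have := Finset.mem_range.1 hi; omega
    rw [Finset.sum_congr rfl e, Finset.sum_const, Finset.card_erase_of_mem hi, Finset.card_range,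
      nsmul_eq_mul, Nat.cast_sub hn, Nat.cast_one]
    have b1 : μ.real (U i ∩ U i) ≤ 1 := measureReal_le_one
    have b2 : μ.real (V i ∩ V i) ≤ 1 := measureReal_le_one
    have b3 : 0 ≤ μ.real (U i ∩ V i) := measureReal_nonneg
    linarith
  have hb2 := Finset.sum_le_sum hb1
  rw [Finset.sum_const, Finset.card_range, nsmul_eq_mul] at hb2
  have hb3 : t ^ 2 * μ.real (A ∩ A) ≤ t ^ 2 :=
    mul_le_of_le_one_right (sq_nonneg _) measureReal_le_one
  rw [Finset.sum_const, Finset.card_range, nsmul_eq_mul] at h0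
  linarith

theorem second_moment_nonneg {μ : Measure Ω} [IsProbabilityMeasure μ] {U V : ℕ → Set Ω}
    (hU : ∀ i, MeasurableSet (U i)) (hV : ∀ i, MeasurableSet (V i)) {α β γ : ℝ}
    (hα : ∀ i j, i ≠ j → μ.real (U i ∩ U j) = α) (hβ : ∀ i j, i ≠ j → μ.real (V i ∩ V j) = β)
    (hγ : ∀ i j, i ≠ j → μ.real (U i ∩ V j) = γ) : 0 ≤ α - 2 * γ + β := by
  by_contra! h
  obtain ⟨n, hn⟩ := exists_nat_gt (2 / -(α - 2 * γ + β))
  have h1 := integral_sq_sum_indicator_sub hU hV hα hβ hγ MeasurableSet.empty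
    (a := 0) (b := 0) (by simp) (by simp) (n + 1) 0
  rw [div_lt_iff₀ (by linarith)] at hn
  push_cast at h1
  have : (0 : ℝ) ≤ n := n.cast_nonneg
  nlinarith

theorem eq_of_second_moment_eq_zero {μ : Measure Ω} [IsProbabilityMeasure μ] {U V : ℕ → Set Ω}
    (hU : ∀ i, MeasurableSet (U i)) (hV : ∀ i, MeasurableSet (V i)) {α β γ : ℝ}
    (hα : ∀ i j, i ≠ j → μ.real (U i ∩ U j) = α) (hβ : ∀ i j, i ≠ j → μ.real (V i ∩ V j) = β)
    (hγ : ∀ i j, i ≠ j → μ.real (U i ∩ V j) = γ) (h : α - 2 * γ + β = 0)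
    {A : Set Ω} (hA : MeasurableSet A) {a b : ℝ}
    (ha : ∀ i, μ.real (A ∩ U i) = a) (hb : ∀ i, μ.real (A ∩ V i) = b) : a = b := by
  by_contra hne
  have hd : 0 < (a - b) ^ 2 := by have := sub_ne_zero.2 hne; positivity
  obtain ⟨n, hn⟩ := exists_nat_gt (2 / (a - b) ^ 2)
  -- This `t` minimises the bound, which becomes `2n - n²(a - b)²`, negative for large `n`.
  have h1 := integral_sq_sum_indicator_sub hU hV hα hβ hγ hA ha hb n (n * (a - b))
  rw [h] at h1
  rw [div_lt_iff₀ hd] at hn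
  have : (0 : ℝ) < n := by
    rcases Nat.eq_zero_or_pos n with rfl | h'
    · norm_num at hn
    · exact_mod_cast h'
  nlinarith

end SecondMoment

/-! ### Consistency for tuples, and the maximum of a triple. -/

open TotalOrdering in
theorem SimpleGraph.IsConsistentOrder.measure_chainEvent_eq {V : Type*} {G : SimpleGraph V}
    {μ : Measure (TotalOrdering V)} (hμ : G.IsConsistentOrder μ) {k : ℕ} {x y : Fin k → V}
    (hx : Function.Injective x) (hy : Function.Injective y)
    (h : ∀ i j, G.Adj (x i) (x j) ↔ G.Adj (y i) (y j)) :
    μ (chainEvent x) = μ (chainEvent y) := by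
  let e : Set.range x ≃ Set.range y := (Equiv.ofInjective x hx).symm.trans (Equiv.ofInjective y hy)
  have he : ∀ i (hi : x i ∈ Set.range x), (e ⟨x i, hi⟩ : V) = y i := by
    intro i hi
    have : (⟨x i, hi⟩ : Set.range x) = Equiv.ofInjective x hx i := rfl
    rw [this]
    simp [e]
  have hadj : ∀ {a b : Set.range x}, (G.induce (Set.range y)).Adj (e a) (e b) ↔
      (G.induce (Set.range x)).Adj a b := by
    rintro ⟨a, ha⟩ ⟨b, hb⟩
    obtain ⟨i, rfl⟩ := id ha
    obtain ⟨j, rfl⟩ := id hb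
    simp only [SimpleGraph.comap_adj, Function.Embedding.subtype_apply, he, h i j]
  have := hμ (Set.range x) (Set.range y) (Set.finite_range x) (Set.finite_range y)
    ⟨e, hadj⟩ k fun i => ⟨x i, Set.mem_range_self i⟩
  refine this.trans (congrArg (fun z : Fin k → V => μ (chainEvent z)) (funext fun i => ?_))
  exact he i _

namespace SimpleGraph.IsConsistentOrder

open TotalOrdering

variable {V : Type*} {G : SimpleGraph V} {μ : Measure (TotalOrdering V)}

theorem measure_patternEvent_eq (hμ : G.IsConsistentOrder μ) {k : ℕ} {x y : Fin k → V}
    (hx : Function.Injective x) (hy : Function.Injective y)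
    (h : ∀ i j, G.Adj (x i) (x j) ↔ G.Adj (y i) (y j)) (P : (Fin k → Fin k → Prop) → Prop) :
    μ (patternEvent x P) = μ (patternEvent y P) :=
  measure_patternEvent_congr hx hy (fun σ => hμ.measure_chainEvent_eq (hx.comp σ.injective)
    (hy.comp σ.injective) fun i j => h (σ i) (σ j)) P

end SimpleGraph.IsConsistentOrder

/-- The probability that `c` comes after both `a` and `b`. -/
noncomputable def maxProb {V : Type*} (μ : Measure (TotalOrdering V)) (a b c : V) : ℝ :=
  μ.real ({r | r.lt a c} ∩ {r | r.lt b c})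

section MaxProb

open TotalOrdering

variable {V : Type*} {G : SimpleGraph V} {μ : Measure (TotalOrdering V)}

theorem maxProb_swap (a b c : V) : maxProb μ a b c = maxProb μ b a c := by
  rw [maxProb, Set.inter_comm, maxProb]

theorem maxProb_add_add [IsProbabilityMeasure μ] {a b c : V} (hab : a ≠ b) (hac : a ≠ c)
    (hbc : b ≠ c) : maxProb μ a b c + maxProb μ a c b + maxProb μ b c a = 1 := by
  have hm : ∀ a b c : V, MeasurableSet ({r | r.lt a c} ∩ {r : TotalOrdering V | r.lt b c}) :=
    fun a b c => (TotalOrdering.measurableSet_lt a c).inter (TotalOrdering.measurableSet_lt b c)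
  unfold maxProb
  rw [← measureReal_union _ (hm _ _ _), ← measureReal_union _ (hm _ _ _)]
  · convert probReal_univ (μ := μ)
    refine Set.eq_univ_of_forall fun r => ?_
    simp only [Set.mem_union, Set.mem_inter_iff, Set.mem_ofPred_eq]
    have h1 := r.lt_or_gt hab
    have h2 := r.lt_or_gt hac
    have h3 := r.lt_or_gt hbc
    have h4 : r.lt a c → r.lt c b → r.lt a b := r.lt_trans
    have h5 : r.lt b c → r.lt c a → r.lt b a := r.lt_trans
    tauto
  · refine Set.disjoint_left.2 fun r hr hr' => ?_
    rcases hr with hr | hr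
    · exact r.lt_asymm hr.1 hr'.2
    · exact r.lt_asymm hr.1 hr'.1
  · exact Set.disjoint_left.2 fun r hr hr' => r.lt_asymm hr.2 hr'.2

theorem maxProb_congr (hμ : G.IsConsistentOrder μ) {a b c a' b' c' : V}
    (hab : a ≠ b) (hac : a ≠ c) (hbc : b ≠ c) (hab' : a' ≠ b') (hac' : a' ≠ c') (hbc' : b' ≠ c')
    (h1 : G.Adj a b ↔ G.Adj a' b') (h2 : G.Adj a c ↔ G.Adj a' c')
    (h3 : G.Adj b c ↔ G.Adj b' c') : maxProb μ a b c = maxProb μ a' b' c' := by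
  have hinj : ∀ {a b c : V}, a ≠ b → a ≠ c → b ≠ c → Function.Injective ![a, b, c] := by
    intro a b c h h' h'' i j hij
    fin_cases i <;> fin_cases j <;> simp_all [eq_comm]
  have := hμ.measure_patternEvent_eq (hinj hab hac hbc) (hinj hab' hac' hbc') (fun i j => by
    fin_cases i <;> fin_cases j <;> simp [h1, h2, h3, G.adj_comm b a, G.adj_comm c a,
      G.adj_comm c b, G.adj_comm b' a', G.adj_comm c' a', G.adj_comm c' b'])
    (fun f => f 0 2 ∧ f 1 2)
  exact congrArg ENNReal.toReal this

open Classical in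
/-- The probability that the third vertex of a triple is its maximum, in terms of the adjacencies
in the triple, the probability `p` that the centre of an induced path is its maximum, and the
probability `q` that the isolated vertex of an edge plus a vertex is its maximum. -/
noncomputable def tripleValue (p q : ℝ) (ab ac bc : Prop) : ℝ :=
  if ab then
    if ac then if bc then 1 / 3 else (1 - p) / 2
    else if bc then (1 - p) / 2 else q
  else
    if ac then if bc then p else (1 - q) / 2
    else if bc then (1 - q) / 2 else 1 / 3

theorem tripleValue_third (ab ac bc : Prop) : tripleValue (1 / 3) (1 / 3) ab ac bc = 1 / 3 := by
  unfold tripleValue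
  split_ifs <;> norm_num

theorem tripleValue_not (p q : ℝ) (ab ac bc : Prop) :
    tripleValue q p (¬ab) (¬ac) (¬bc) = tripleValue p q ab ac bc := by
  unfold tripleValue
  by_cases ab <;> by_cases ac <;> by_cases bc <;> simp [*]

/-- Every graph on three vertices has an automorphism exchanging two of them. Since the three
probabilities sum to 1, at most one is free. If a triple type does not occur, its parameter is set
to 0. -/
theorem exists_maxProb_eq_tripleValue [IsProbabilityMeasure μ] (hμ : G.IsConsistentOrder μ) :
    ∃ p q : ℝ, ∀ a b c : V, a ≠ b → a ≠ c → b ≠ c →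
      maxProb μ a b c = tripleValue p q (G.Adj a b) (G.Adj a c) (G.Adj b c) := by
  have hp : ∃ p : ℝ, ∀ a b c : V, a ≠ b → a ≠ c → b ≠ c → ¬G.Adj a b → G.Adj a c → G.Adj b c →
      maxProb μ a b c = p := by
    by_cases h : ∃ a b c : V, a ≠ b ∧ a ≠ c ∧ b ≠ c ∧ ¬G.Adj a b ∧ G.Adj a c ∧ G.Adj b c
    · obtain ⟨a, b, c, hab, hac, hbc, h1, h2, h3⟩ := h
      refine ⟨maxProb μ a b c, fun a' b' c' hab' hac' hbc' h1' h2' h3' => ?_⟩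
      exact maxProb_congr hμ hab' hac' hbc' hab hac hbc (by tauto) (by tauto) (by tauto)
    · exact ⟨0, fun a b c h1 h2 h3 h4 h5 h6 => absurd ⟨a, b, c, h1, h2, h3, h4, h5, h6⟩ h⟩
  have hq : ∃ q : ℝ, ∀ a b c : V, a ≠ b → a ≠ c → b ≠ c → G.Adj a b → ¬G.Adj a c → ¬G.Adj b c →
      maxProb μ a b c = q := by
    by_cases h : ∃ a b c : V, a ≠ b ∧ a ≠ c ∧ b ≠ c ∧ G.Adj a b ∧ ¬G.Adj a c ∧ ¬G.Adj b c
    · obtain ⟨a, b, c, hab, hac, hbc, h1, h2, h3⟩ := h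
      refine ⟨maxProb μ a b c, fun a' b' c' hab' hac' hbc' h1' h2' h3' => ?_⟩
      exact maxProb_congr hμ hab' hac' hbc' hab hac hbc (by tauto) (by tauto) (by tauto)
    · exact ⟨0, fun a b c h1 h2 h3 h4 h5 h6 => absurd ⟨a, b, c, h1, h2, h3, h4, h5, h6⟩ h⟩
  obtain ⟨p, hp⟩ := hp
  obtain ⟨q, hq⟩ := hq
  -- if exchanging `b` and `c` preserves adjacencies, they are equally likely to be the maximum
  have hswap : ∀ a b c : V, a ≠ b → a ≠ c → b ≠ c → (G.Adj a b ↔ G.Adj a c) →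
      maxProb μ a b c = maxProb μ a c b := fun a b c hab hac hbc h =>
    maxProb_congr hμ hab hac hbc hac hab hbc.symm h h.symm (G.adj_comm b c)
  refine ⟨p, q, fun a b c hab hac hbc => ?_⟩
  have hsum := maxProb_add_add (μ := μ) hab hac hbc
  have s1 := hswap a b c hab hac hbc
  have s2 := hswap b a c hab.symm hbc hac
  have s3 := hswap c a b hac.symm hbc.symm hab
  rw [maxProb_swap b a c] at s2
  rw [maxProb_swap c a b, maxProb_swap c b a] at s3
  have p1 := hp a b c hab hac hbc
  have p2 := hp a c b hac hab hbc.symm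
  have p3 := hp b c a hbc hab.symm hac.symm
  have q1 := hq a b c hab hac hbc
  have q2 := hq a c b hac hab hbc.symm
  have q3 := hq b c a hbc hab.symm hac.symm
  rw [G.adj_comm c b] at p2 q2 s3
  rw [G.adj_comm b a] at p3 q3 s2
  rw [G.adj_comm c a] at p3 q3 s3
  unfold tripleValue
  by_cases hAB : G.Adj a b <;> by_cases hAC : G.Adj a c <;> by_cases hBC : G.Adj b c <;>
    simp only [hAB, hAC, hBC, if_true, if_false, true_implies, false_implies, not_true, not_false_iff,
      iff_true, iff_false] at * <;> linarith

end MaxProb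

/-! ### Combinatorics of the second moment conditions. -/

section LoopedGraph

variable {V : Type*} {R : V → V → Prop} {p q : ℝ}

/-- The second moment inequalities, and the consequences of equality in them, for the values of
`tripleValue` on the blow-up of a graph with loops. -/
structure SecondMomentConditions (R : V → V → Prop) (p q : ℝ) : Prop where
  symm : ∀ u v, R u v → R v u
  nonneg : ∀ u v w, 0 ≤ tripleValue p q (R u u) (R u w) (R u w) -
    2 * tripleValue p q (R u v) (R u w) (R v w) + tripleValue p q (R v v) (R v w) (R v w)
  eq_of_eq_zero : ∀ u v w z, tripleValue p q (R u u) (R u w) (R u w) -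
    2 * tripleValue p q (R u v) (R u w) (R v w) + tripleValue p q (R v v) (R v w) (R v w) = 0 →
    tripleValue p q (R z u) (R z w) (R u w) = tripleValue p q (R z v) (R z w) (R v w)

namespace SecondMomentConditions

/-- Complementing exchanges induced paths with edges plus a vertex, so each lemma below also yields
its dual. -/
theorem compl (h : SecondMomentConditions R p q) :
    SecondMomentConditions (fun u v => ¬R u v) q p where
  symm u v := mt (h.symm v u)
  nonneg u v w := by simpa only [tripleValue_not] using h.nonneg u v w
  eq_of_eq_zero u v w z := by simpa only [tripleValue_not] using h.eq_of_eq_zero u v w z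

theorem third_of_path_of_loops (h : SecondMomentConditions R p q) {a b c : V} (ha : R a a)
    (hb : R b b) (hc : R c c) (hab : R a b) (hbc : R b c) (hac : ¬R a c) :
    p = 1 / 3 ∧ q = 1 / 3 := by
  have hba := h.symm _ _ hab
  have hcb := h.symm _ _ hbc
  have hca := mt (h.symm _ _) hac
  -- This gives `p = q`; the two inequalities give `p ≤ 1/3` and `q ≥ 1/3`.
  have h1 := h.eq_of_eq_zero a b a c (by simp [tripleValue, *]; norm_num)
  have h2 := h.nonneg a c b
  have h3 := h.nonneg a c a
  simp only [tripleValue, *, if_true, if_false] at h1 h2 h3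
  constructor <;> linarith

theorem third_of_edge_loops_separated (h : SecondMomentConditions R p q) {a b e : V} (ha : R a a)
    (hb : R b b) (hab : R a b) (hea : R e a) (heb : ¬R e b) :
    p = 1 / 3 ∧ q = 1 / 3 := by
  have hba := h.symm _ _ hab
  have hae := h.symm _ _ hea
  have hbe := mt (h.symm _ _) heb
  have h1 := h.eq_of_eq_zero a b a e (by simp [tripleValue, *]; norm_num)
  have h2 := h.eq_of_eq_zero a b b e (by simp [tripleValue, *]; norm_num)
  simp only [tripleValue, *, if_true, if_false] at h1 h2
  constructor <;> linarith

theorem third_of_nonadj_loops (h : SecondMomentConditions R p q) {a b e : V} (ha : R a a)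
    (hb : R b b) (he : ¬R e e) (hab : ¬R a b) (hea : R e a) :
    p = 1 / 3 ∧ q = 1 / 3 := by
  have hba := mt (h.symm _ _) hab
  have hae := h.symm _ _ hea
  -- This is `p ≥ 1/3`. If `e` is adjacent to `b`, then `p ≤ 1/3` as well, and equality here gives
  -- `p = q`.
  have h0 := h.nonneg e a a
  by_cases heb : R e b
  · have hbe := h.symm _ _ heb
    have h1 := h.nonneg a b e
    have hp : p = 1 / 3 := by
      simp only [tripleValue, *, if_true, if_false] at h0 h1
      linarith
    have h2 := h.eq_of_eq_zero e a a b (by simp [tripleValue, *]; norm_num)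
    simp only [tripleValue, *, if_true, if_false] at h2
    constructor <;> linarith
  · have hbe := mt (h.symm _ _) heb
    have h1 := h.nonneg e b b
    have h2 := h.nonneg e a b
    have hq : q = 1 / 3 := by
      simp only [tripleValue, *, if_true, if_false] at h1 h2
      linarith
    have h3 := h.eq_of_eq_zero e b e a (by simp [tripleValue, *]; norm_num)
    simp only [tripleValue, *, if_true, if_false] at h3
    constructor <;> linarith

theorem isTrans_or_isTrans_not (h : SecondMomentConditions R p q)
    (hpq : ¬(p = 1 / 3 ∧ q = 1 / 3)) :
    (∀ a b c, R a b → R b c → R a c) ∨ (∀ a b c, ¬R a b → ¬R b c → ¬R a c) := by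
  have hqp : ¬(q = 1 / 3 ∧ p = 1 / 3) := fun h => hpq h.symm
  have hs : ∀ u v, R u v ↔ R v u := fun u v => ⟨h.symm u v, h.symm v u⟩
  have A1 : ∀ a b c, R a a → R b b → R c c → R a b → R b c → R a c := fun a b c ha hb hc hab hbc =>
    by_contra fun hac => hpq (h.third_of_path_of_loops ha hb hc hab hbc hac)
  have A2 : ∀ a b e, R a a → R b b → R a b → R e a → R e b :=
    fun a b e ha hb hab hea =>
      by_contra fun heb => hpq (h.third_of_edge_loops_separated ha hb hab hea heb)
  have A3 : ∀ a b e, R a a → R b b → ¬R e e → R e a → R a b := fun a b e ha hb he hea =>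
    by_contra fun hab => hpq (h.third_of_nonadj_loops ha hb he hab hea)
  have B1 : ∀ a b c, ¬R a a → ¬R b b → ¬R c c → ¬R a b → ¬R b c → ¬R a c :=
    fun a b c ha hb hc hab hbc hac =>
      hqp (h.compl.third_of_path_of_loops ha hb hc hab hbc (not_not.2 hac))
  have B2 : ∀ a b e, ¬R a a → ¬R b b → ¬R a b → ¬R e a → ¬R e b :=
    fun a b e ha hb hab hea heb =>
      hqp (h.compl.third_of_edge_loops_separated ha hb hab hea (not_not.2 heb))
  have B3 : ∀ a b e, ¬R a a → ¬R b b → R e e → ¬R e a → ¬R a b := fun a b e ha hb he hea hab =>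
    hqp (h.compl.third_of_nonadj_loops ha hb (not_not.2 he) (not_not.2 hab) hea)
  -- One adjacency between an unlooped and a looped vertex spreads: every pair containing a looped
  -- vertex becomes adjacent, so non-adjacency lives on the unlooped vertices, where `B1` applies.
  by_cases hex : ∃ e f, ¬R e e ∧ R f f ∧ R e f
  · obtain ⟨e, f, he, hf, hef⟩ := hex
    have h1 : ∀ a, R a a → R e a := fun a ha => A2 f a e hf ha (A3 f a e hf ha he hef) hef
    have h2 : ∀ a b, R a a → R b b → R a b := fun a b ha hb => A3 a b e ha hb he (h1 a ha)
    have h3 : ∀ a b, R a a → ¬R b b → R a b := fun a b ha hb => by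
      by_contra hab
      exact B2 b e a hb he (B3 b e a hb he ha hab) hab ((hs _ _).1 (h1 a ha))
    refine Or.inr fun a b c hab hbc => ?_
    have hb : ¬R b b := fun hb => by
      by_cases ha : R a a
      · exact hab (h2 a b ha hb)
      · exact hab ((hs _ _).1 (h3 b a hb ha))
    have ha : ¬R a a := fun ha => hab (h3 a b ha hb)
    have hc : ¬R c c := fun hc => hbc ((hs _ _).1 (h3 c b hc hb))
    exact B1 a b c ha hb hc hab hbc
  · push Not at hex
    by_cases hf : ∃ f, R f f
    · obtain ⟨f, hf⟩ := hf
      -- With no unlooped vertex adjacent to a looped one, the loop at `f` makes the unlooped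
      -- vertices pairwise non-adjacent. Adjacency lives on the looped vertices, where `A1` applies.
      have h1 : ∀ a b, R a b → R a a := by
        intro a b hab
        by_contra ha
        by_cases hb : R b b
        · exact hex a b ha hb hab
        · exact B3 a b f ha hb hf (fun h' => hex a f ha hf ((hs _ _).1 h')) hab
      refine Or.inl fun a b c hab hbc => ?_
      exact A1 a b c (h1 a b hab) (h1 b c hbc) (h1 c b ((hs _ _).1 hbc)) hab hbc
    · push Not at hf
      exact Or.inr fun a b c => B1 a b c (hf a) (hf b) (hf c)

end SecondMomentConditions

end LoopedGraph

/-! ### Second moment conditions in the blow-up. -/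

namespace Template

open TotalOrdering

variable {V : Type*} {G : Template V} {μ : Measure (TotalOrdering (V × ℕ))}

/-- The adjacency relation of a template, where full vertices are regarded as looped. -/
def LoopAdj (G : Template V) (u v : V) : Prop := (u = v ∧ u ∈ G.full) ∨ G.graph.Adj u v

theorem LoopAdj.symm {u v : V} (h : G.LoopAdj u v) : G.LoopAdj v u := by
  rcases h with ⟨rfl, h⟩ | h
  · exact Or.inl ⟨rfl, h⟩
  · exact Or.inr h.symm

theorem blowUp_adj_iff {x y : V × ℕ} : G.blowUp.Adj x y ↔ x ≠ y ∧ G.LoopAdj x.1 y.1 := by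
  obtain ⟨u, i⟩ := x
  obtain ⟨v, j⟩ := y
  simp only [blowUp, LoopAdj, ne_eq, Prod.mk.injEq, not_and]
  constructor
  · rintro (⟨rfl, hf, hij⟩ | h)
    · exact ⟨fun _ => hij, Or.inl ⟨rfl, hf⟩⟩
    · exact ⟨fun h' => absurd h' h.ne, Or.inr h⟩
  · rintro ⟨h, (⟨rfl, hf⟩ | h')⟩
    · exact Or.inl ⟨rfl, hf, h rfl⟩
    · exact Or.inr h'

theorem blowUp_adj_iff_of_ne {x y : V × ℕ} (h : x ≠ y) :
    G.blowUp.Adj x y ↔ G.LoopAdj x.1 y.1 := by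
  simp [blowUp_adj_iff, h]

theorem loopAdj_self {u : V} : G.LoopAdj u u ↔ u ∈ G.full := by simp [LoopAdj]

theorem loopAdj_of_ne {u v : V} (h : u ≠ v) : G.LoopAdj u v ↔ G.graph.Adj u v := by
  simp [LoopAdj, h]

theorem exists_secondMomentConditions [IsProbabilityMeasure μ]
    (hμ : G.blowUp.IsConsistentOrder μ) : ∃ p q : ℝ, SecondMomentConditions G.LoopAdj p q ∧
      ∀ a b c : V × ℕ, a ≠ b → a ≠ c → b ≠ c → maxProb μ a b c =
        tripleValue p q (G.LoopAdj a.1 b.1) (G.LoopAdj a.1 c.1) (G.LoopAdj b.1 c.1) := by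
  obtain ⟨p, q, hpq⟩ := exists_maxProb_eq_tripleValue hμ
  have key : ∀ a b c : V × ℕ, a ≠ b → a ≠ c → b ≠ c → maxProb μ a b c =
        tripleValue p q (G.LoopAdj a.1 b.1) (G.LoopAdj a.1 c.1) (G.LoopAdj b.1 c.1) := by
    intro a b c hab hac hbc
    rw [hpq a b c hab hac hbc, blowUp_adj_iff_of_ne hab, blowUp_adj_iff_of_ne hac,
      blowUp_adj_iff_of_ne hbc]
  -- Copy 0 is kept for `w`, copy 1 for `z`, and copies from 2 on for the sequences, so the vertices
  -- differ even if the parts coincide.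
  have hU : ∀ (u v w : V) (i j : ℕ), i ≠ j →
      μ.real ({r | r.lt (u, i + 2) (w, 0)} ∩ {r | r.lt (v, j + 2) (w, 0)}) =
        tripleValue p q (G.LoopAdj u v) (G.LoopAdj u w) (G.LoopAdj v w) := fun u v w i j hij =>
    key (u, i + 2) (v, j + 2) (w, 0) (by simp [hij]) (by simp) (by simp)
  have hA : ∀ (u w z : V) (i : ℕ),
      μ.real ({r | r.lt (z, 1) (w, 0)} ∩ {r | r.lt (u, i + 2) (w, 0)}) =
        tripleValue p q (G.LoopAdj z u) (G.LoopAdj z w) (G.LoopAdj u w) := fun u w z i =>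
    key (z, 1) (u, i + 2) (w, 0) (by simp) (by simp) (by simp)
  refine ⟨p, q, ⟨fun u v h => h.symm, fun u v w => ?_, fun u v w z h => ?_⟩, key⟩
  · exact second_moment_nonneg (fun i => measurableSet_lt _ _) (fun i => measurableSet_lt _ _)
      (hU u u w) (hU v v w) (hU u v w)
  · exact eq_of_second_moment_eq_zero (fun i => measurableSet_lt _ _)
      (fun i => measurableSet_lt _ _) (hU u u w) (hU v v w) (hU u v w) h
      (measurableSet_lt _ _) (hA u w z) (hA v w z)

/-! ### Uniformity when all triple probabilities are 1/3. -/

/-- Vertices in the same part of the blow-up can be exchanged. -/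
theorem measure_patternEvent_update_eq (hμ : G.blowUp.IsConsistentOrder μ) {k : ℕ}
    {x : Fin k → V × ℕ} (hx : Function.Injective x) {j : Fin k} {y z : V × ℕ}
    (hy : ∀ i, i ≠ j → x i ≠ y) (hz : ∀ i, i ≠ j → x i ≠ z) (hyz : y.1 = z.1)
    (P : (Fin k → Fin k → Prop) → Prop) :
    μ (patternEvent (Function.update x j y) P) = μ (patternEvent (Function.update x j z) P) := by
  have hinj : ∀ y : V × ℕ, (∀ i, i ≠ j → x i ≠ y) → Function.Injective (Function.update x j y) := by
    intro y hy a b hab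
    by_cases ha : a = j <;> by_cases hb : b = j
    · rw [ha, hb]
    · subst ha
      rw [Function.update_self, Function.update_of_ne hb] at hab
      exact absurd hab.symm (hy b hb)
    · subst hb
      rw [Function.update_self, Function.update_of_ne ha] at hab
      exact absurd hab (hy a ha)
    · rw [Function.update_of_ne ha, Function.update_of_ne hb] at hab
      exact hx hab
  refine hμ.measure_patternEvent_eq (hinj y hy) (hinj z hz) (fun a b => ?_) P
  rw [blowUp_adj_iff, blowUp_adj_iff, (hinj y hy).ne_iff, (hinj z hz).ne_iff]
  refine and_congr_right fun _ => ?_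
  have : ∀ a, (Function.update x j y a).1 = (Function.update x j z a).1 := by
    intro a
    by_cases ha : a = j
    · subst ha; simpa using hyz
    · simp [ha]
  rw [this, this]

/-- Given that the other vertices are in order, the `j`-th one fits its place iff it is below its
successor but not below its predecessor. By the equality case of the second moment, each of these
probabilities is unchanged when the `j`-th vertex is replaced. A missing successor imposes no
condition; a missing predecessor removes nothing. -/
theorem measure_chainEvent_update_eq [IsProbabilityMeasure μ] (hμ : G.blowUp.IsConsistentOrder μ)
    (h3 : ∀ a b c : V × ℕ, a ≠ b → a ≠ c → b ≠ c → maxProb μ a b c = 1 / 3) {k : ℕ}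
    {x : Fin k → V × ℕ} (hx : Function.Injective x) (j : Fin k) {y : V × ℕ}
    (hy : y ∉ Set.range x) :
    μ (chainEvent (Function.update x j y)) = μ (chainEvent x) := by
  obtain ⟨N, hN⟩ : ∃ N, ∀ i, (x i).2 < N := by
    obtain ⟨N, hN⟩ := (Set.finite_range fun i => (x i).2).bddAbove
    exact ⟨N + 1, fun i => Nat.lt_succ_of_le (hN ⟨i, rfl⟩)⟩
  have hfresh : ∀ (u : V) (n : ℕ) (i : Fin k), x i ≠ (u, N + n) := fun u n i h => by
    have := hN i
    rw [h] at this
    simp at this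
  have hself : Function.update x j (x j) = x := Function.update_eq_self j x
  let A : Set (TotalOrdering (V × ℕ)) :=
    patternEvent x fun f => ∀ a b, a < b → a ≠ j → b ≠ j → f a b
  have hA : MeasurableSet A := measurableSet_patternEvent _ _
  -- the event `A` does not involve `x j`
  have hAu : ∀ (z : V × ℕ) (l : Fin k), l ≠ j → A ∩ {r | r.lt z (x l)} =
      patternEvent (Function.update x j z)
        fun f => (∀ a b, a < b → a ≠ j → b ≠ j → f a b) ∧ f j l := by
    intro z l hl
    ext r
    simp only [A, patternEvent, Set.mem_inter_iff, Set.mem_ofPred_eq, Function.update_self,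
      Function.update_of_ne hl]
    refine and_congr_left fun _ => forall₅_congr fun a b _ ha hb => ?_
    rw [Function.update_of_ne ha, Function.update_of_ne hb]
  have hlast : ∀ l, l ≠ j → μ (A ∩ {r | r.lt y (x l)}) = μ (A ∩ {r | r.lt (x j) (x l)}) := by
    intro l hl
    have hne : ∀ (u : V) (n : ℕ), ((u, N + n) : V × ℕ) ≠ x l := fun u n => (hfresh u n l).symm
    have hmax : ∀ (u v : V) (m n : ℕ), m ≠ n →
        μ.real ({r | r.lt (u, N + m) (x l)} ∩ {r | r.lt (v, N + n) (x l)}) = 1 / 3 :=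
      fun u v m n hmn => h3 _ _ _ (by simp [hmn]) (hne u m) (hne v n)
    have hconst : ∀ (z : V × ℕ), (∀ i, i ≠ j → x i ≠ z) → ∀ n : ℕ,
        μ.real (A ∩ {r | r.lt (z.1, N + n) (x l)}) = μ.real (A ∩ {r | r.lt z (x l)}) := by
      intro z hz n
      rw [hAu _ l hl, hAu _ l hl, Measure.real, Measure.real,
        measure_patternEvent_update_eq hμ hx (fun i _ => hfresh z.1 n i) hz rfl]
    -- The sequences are fresh copies from the parts of `y` and `x j`; exchangeability within a
    -- part, in `hconst`, leads back to `y` and `x j`.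
    have := eq_of_second_moment_eq_zero (fun n => measurableSet_lt _ _)
      (fun n => measurableSet_lt _ _) (hmax y.1 y.1) (hmax (x j).1 (x j).1) (hmax y.1 (x j).1)
      (by norm_num) hA (hconst y fun i _ hi => hy ⟨i, hi⟩) (hconst (x j) fun i hi => hx.ne hi)
    exact (measureReal_eq_measureReal_iff).1 this
  -- a chain event is a difference of two events of the form above
  have hupper : ∀ (z : V × ℕ) (r : TotalOrdering (V × ℕ)),
      r ∈ (if h : (j : ℕ) + 1 < k then A ∩ {r | r.lt z (x ⟨j + 1, h⟩)} else A) ↔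
        r ∈ A ∧ ∀ h : (j : ℕ) + 1 < k, r.lt z (x ⟨j + 1, h⟩) := by
    intro z r
    split_ifs with h <;> simp [h]
  have hlower : ∀ (z : V × ℕ) (r : TotalOrdering (V × ℕ)),
      r ∈ (if h : 0 < (j : ℕ) then A ∩ {r | r.lt z (x ⟨j - 1, by omega⟩)} else ∅) ↔
        ∃ _ : 0 < (j : ℕ), r ∈ A ∧ r.lt z (x ⟨j - 1, by omega⟩) := by
    intro z r
    split_ifs with h <;> simp [h]
  have hdiff : ∀ z : V × ℕ, (∀ i, i ≠ j → x i ≠ z) → chainEvent (Function.update x j z) =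
      (if h : (j : ℕ) + 1 < k then A ∩ {r | r.lt z (x ⟨j + 1, h⟩)} else A) \
      (if h : 0 < (j : ℕ) then A ∩ {r | r.lt z (x ⟨j - 1, by omega⟩)} else ∅) := by
    intro z hz
    ext r
    rw [Set.mem_sdiff, hupper, hlower]
    constructor
    · intro hr
      refine ⟨⟨fun a b hab ha hb => ?_, fun h => ?_⟩, ?_⟩
      · simpa [ha, hb] using hr a b hab
      · have hj : (⟨j + 1, h⟩ : Fin k) ≠ j := by simp [Fin.ext_iff]
        simpa [hj] using hr j ⟨j + 1, h⟩ (by simp [Fin.lt_def])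
      · rintro ⟨h, -, hlt⟩
        have hj : (⟨j - 1, by omega⟩ : Fin k) ≠ j := by simp [Fin.ext_iff]; omega
        have := hr ⟨j - 1, by omega⟩ j (by simp [Fin.lt_def]; omega)
        rw [Function.update_self, Function.update_of_ne hj] at this
        exact r.lt_asymm this hlt
    · rintro ⟨⟨hrA, hup⟩, hlow⟩ a b hab
      by_cases ha : a = j
      · subst ha
        have hab' : (a : ℕ) < b := hab
        rw [Function.update_self, Function.update_of_ne hab.ne']
        have h : (a : ℕ) + 1 < k := by omega
        by_cases hb : b = ⟨a + 1, h⟩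
        · exact hb ▸ hup h
        · refine r.lt_trans (hup h) (hrA _ _ ?_ ?_ hab.ne')
          · rw [Fin.ext_iff] at hb
            simp only [Fin.lt_def] at hb ⊢
            omega
          · simp [Fin.ext_iff]
      by_cases hb : b = j
      · subst hb
        have hab' : (a : ℕ) < b := hab
        rw [Function.update_self, Function.update_of_ne ha]
        have h : 0 < (b : ℕ) := by omega
        have hne : (⟨b - 1, by omega⟩ : Fin k) ≠ b := by simp [Fin.ext_iff]; omega
        have hlt : r.lt (x ⟨b - 1, by omega⟩) z :=
          (r.lt_or_gt (hz _ hne)).resolve_right fun h' => hlow ⟨h, hrA, h'⟩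
        by_cases ha' : a = ⟨b - 1, by omega⟩
        · exact ha' ▸ hlt
        · refine r.lt_trans (hrA _ _ ?_ ha hne) hlt
          rw [Fin.ext_iff] at ha'
          simp only [Fin.lt_def] at ha' ⊢
          omega
      · rw [Function.update_of_ne ha, Function.update_of_ne hb]
        exact hrA a b hab ha hb
  have hsub : ∀ z : V × ℕ,
      (if h : 0 < (j : ℕ) then A ∩ {r | r.lt z (x ⟨j - 1, by omega⟩)} else ∅) ⊆
      (if h : (j : ℕ) + 1 < k then A ∩ {r | r.lt z (x ⟨j + 1, h⟩)} else A) := by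
    intro z r
    rw [hupper, hlower]
    rintro ⟨h, hrA, hlt⟩
    refine ⟨hrA, fun h' => r.lt_trans hlt (hrA _ _ ?_ ?_ ?_)⟩
    · simp only [Fin.lt_def]; omega
    · simp [Fin.ext_iff]; omega
    · simp [Fin.ext_iff]
  have hmeas : ∀ z : V × ℕ, MeasurableSet
      (if h : 0 < (j : ℕ) then A ∩ {r | r.lt z (x ⟨j - 1, by omega⟩)} else ∅) := by
    intro z
    split_ifs
    · exact hA.inter (measurableSet_lt _ _)
    · exact MeasurableSet.empty
  have e := hdiff (x j) fun i hi => hx.ne hi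
  rw [hself] at e
  rw [e, hdiff y fun i _ hi => hy ⟨i, hi⟩,
    measure_sdiff (hsub _) (hmeas _).nullMeasurableSet (measure_ne_top _ _),
    measure_sdiff (hsub _) (hmeas _).nullMeasurableSet (measure_ne_top _ _)]
  congr 1
  · split_ifs with h
    · exact hlast _ (by simp [Fin.ext_iff])
    · rfl
  · split_ifs with h
    · exact hlast _ (by simp [Fin.ext_iff]; omega)
    · rfl

theorem eq_uniformLaw_of_maxProb_eq [IsProbabilityMeasure μ] (hμ : G.blowUp.IsConsistentOrder μ)
    (h3 : ∀ a b c : V × ℕ, a ≠ b → a ≠ c → b ≠ c → maxProb μ a b c = 1 / 3) :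
    μ = uniformLaw (V × ℕ) := by
  refine measure_ext_of_chainEvent fun k x hx => ?_
  obtain ⟨N, hN⟩ : ∃ N, ∀ i, (x i).2 < N := by
    obtain ⟨N, hN⟩ := (Set.finite_range fun i => (x i).2).bddAbove
    exact ⟨N + 1, fun i => Nat.lt_succ_of_le (hN ⟨i, rfl⟩)⟩
  -- A fresh tuple independent of `σ`: each `x ∘ σ` is turned into it one entry at a time, through
  -- the hybrids `z m`.
  let y : Fin k → V × ℕ := fun i => ((x i).1, N + i)
  have hy : ∀ (σ : Equiv.Perm (Fin k)) (i j : Fin k), x (σ i) ≠ y j := fun σ i j h => by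
    have := hN (σ i)
    rw [h] at this
    simp [y] at this
  have key : ∀ σ : Equiv.Perm (Fin k), μ (chainEvent (x ∘ σ)) = μ (chainEvent y) := by
    intro σ
    let z : ℕ → Fin k → V × ℕ := fun m i => if (i : ℕ) < m then y i else x (σ i)
    have hz : ∀ m, Function.Injective (z m) := by
      intro m a b hab
      simp only [z] at hab
      split_ifs at hab
      · exact Fin.ext (by simpa [y] using congrArg Prod.snd hab)
      · exact absurd hab.symm (hy σ _ _)
      · exact absurd hab (hy σ _ _)
      · exact σ.injective (hx hab)
    have hstep : ∀ m ≤ k, μ (chainEvent (z m)) = μ (chainEvent (x ∘ σ)) := by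
      intro m
      induction m with
      | zero =>
        intro _
        congr 2
      | succ m ih =>
        intro hm
        rw [← ih (by omega), ← measure_chainEvent_update_eq hμ h3 (hz m) ⟨m, hm⟩
          (y := y ⟨m, hm⟩)]
        · congr 2
          ext1 i
          by_cases hi : i = ⟨m, hm⟩
          · subst hi; simp [z]
          · have : (i : ℕ) ≠ m := fun h => hi (Fin.ext h)
            rw [Function.update_of_ne hi]
            simp only [z, show (i : ℕ) < m + 1 ↔ (i : ℕ) < m by omega]
        · rintro ⟨i, hi⟩
          simp only [z] at hi
          split_ifs at hi with him
          · have : (i : ℕ) = m := by simpa [y] using congrArg Prod.snd hi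
            omega
          · exact hy σ _ _ hi
    rw [← hstep k le_rfl]
    congr 2
    ext1 i
    simp [z]
  have key' : ∀ σ : Equiv.Perm (Fin k), μ (chainEvent (x ∘ σ)) = μ (chainEvent x) := fun σ =>
    (key σ).trans (key 1).symm
  rw [measure_chainEvent_of_perm_invariant μ hx key',
    measure_chainEvent_of_perm_invariant (uniformLaw _) hx fun σ =>
      uniformLaw_chainEvent_eq (hx.comp σ.injective) hx]

/-! ### From transitivity to the structure of the template. -/

theorem isDisjointUnionOfCliques_blowUp (h : ∀ a b c, G.LoopAdj a b → G.LoopAdj b c →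
    G.LoopAdj a c) : G.blowUp.IsDisjointUnionOfCliques := by
  refine ⟨⟨fun x y => x = y ∨ G.LoopAdj x.1 y.1, fun x => Or.inl rfl, ?_, ?_⟩, fun x y => ?_⟩
  · rintro x y (rfl | h')
    · exact Or.inl rfl
    · exact Or.inr h'.symm
  · rintro x y z (rfl | h1) (rfl | h2)
    · exact Or.inl rfl
    · exact Or.inr h2
    · exact Or.inr h1
    · exact Or.inr (h _ _ _ h1 h2)
  · rw [blowUp_adj_iff]
    change _ ↔ x ≠ y ∧ (x = y ∨ G.LoopAdj x.1 y.1)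
    tauto

theorem isCompleteMultipartite_blowUp (h : ∀ a b c, ¬G.LoopAdj a b → ¬G.LoopAdj b c →
    ¬G.LoopAdj a c) : G.blowUp.IsCompleteMultipartite := by
  refine ⟨fun x y z hxy hyz => ?_⟩
  rw [blowUp_adj_iff] at *
  by_cases h1 : x = y
  · rwa [h1]
  by_cases h2 : y = z
  · rwa [← h2]
  · exact fun h' => h _ _ _ (fun h3 => hxy ⟨h1, h3⟩) (fun h3 => hyz ⟨h2, h3⟩) h'.2

theorem loopAdj_trans_or_of_not_isUniform (hG : ¬G.IsUniform) :
    (∀ a b c, G.LoopAdj a b → G.LoopAdj b c → G.LoopAdj a c) ∨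
      (∀ a b c, ¬G.LoopAdj a b → ¬G.LoopAdj b c → ¬G.LoopAdj a c) := by
  rw [IsUniform, SimpleGraph.IsOrderUniform] at hG
  push Not at hG
  obtain ⟨μ, _, hμ, hne⟩ := hG
  obtain ⟨p, q, hpq, hmax⟩ := exists_secondMomentConditions hμ
  refine hpq.isTrans_or_isTrans_not fun h => hne ?_
  refine eq_uniformLaw_of_maxProb_eq hμ fun a b c hab hac hbc => ?_
  rw [hmax a b c hab hac hbc, h.1, h.2, tripleValue_third]

/-- Under transitivity, the ends of an edge are looped and have the same neighbours, hence are
adjacent full twins. In an edgeless graph any two vertices are twins. -/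
theorem IsReduced.of_loopAdj_trans (hG : G.IsReduced)
    (h : ∀ a b c, G.LoopAdj a b → G.LoopAdj b c → G.LoopAdj a c) :
    G.graph = ⊥ ∧ G.empty.Subsingleton := by
  have h1 : G.graph = ⊥ := by
    ext u v
    refine ⟨fun huv => ?_, fun h => h.elim⟩
    have huv' : G.LoopAdj u v := Or.inr huv
    refine absurd ⟨loopAdj_self.1 (h _ _ _ huv' huv'.symm), loopAdj_self.1 (h _ _ _ huv'.symm huv'),
      huv⟩ (hG u v ⟨huv.ne, ?_⟩).1
    ext w
    simp only [Set.mem_sdiff, SimpleGraph.mem_neighborSet, Set.mem_insert_iff,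
      Set.mem_singleton_iff, not_or]
    refine and_congr_left fun hw => ?_
    rw [← loopAdj_of_ne (Ne.symm hw.1), ← loopAdj_of_ne (Ne.symm hw.2)]
    exact ⟨h _ _ _ huv'.symm, h _ _ _ huv'⟩
  refine ⟨h1, fun u hu v hv => by_contra fun huv => (hG u v ⟨huv, ?_⟩).2 ⟨hu, hv, ?_⟩⟩ <;>
    simp [h1, SimpleGraph.neighborSet]

theorem IsReduced.of_loopAdj_not_trans (hG : G.IsReduced)
    (h : ∀ a b c, ¬G.LoopAdj a b → ¬G.LoopAdj b c → ¬G.LoopAdj a c) :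
    G.graph = ⊤ ∧ G.full.Subsingleton := by
  have hs : ∀ {u v}, ¬G.LoopAdj u v → ¬G.LoopAdj v u := fun h h' => h h'.symm
  have h1 : G.graph = ⊤ := by
    ext u v
    refine ⟨fun huv => huv.ne, fun huv => by_contra fun hadj => ?_⟩
    have huv' : ¬G.LoopAdj u v := by rwa [loopAdj_of_ne huv]
    refine absurd ⟨mt loopAdj_self.2 (h _ _ _ huv' (hs huv')),
      mt loopAdj_self.2 (h _ _ _ (hs huv') huv'), hadj⟩ (hG u v ⟨huv, ?_⟩).2
    ext w
    simp only [Set.mem_sdiff, SimpleGraph.mem_neighborSet, Set.mem_insert_iff,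
      Set.mem_singleton_iff, not_or]
    refine and_congr_left fun hw => ?_
    rw [← loopAdj_of_ne (Ne.symm hw.1), ← loopAdj_of_ne (Ne.symm hw.2), ← not_iff_not]
    exact ⟨h _ _ _ (hs huv'), h _ _ _ huv'⟩
  refine ⟨h1, fun u hu v hv => by_contra fun huv => (hG u v ⟨huv, ?_⟩).1 ⟨hu, hv, ?_⟩⟩
  · ext w
    simp [h1]
  · simpa [h1] using huv

end Template

theorem theorem4p12 {V : Type*} [Finite V] (G : Template V) (hG : ¬ G.IsUniform) :
    (G.IsReduced →
      (G.graph = ⊥ ∧ G.empty.Subsingleton) ∨ (G.graph = ⊤ ∧ G.full.Subsingleton)) ∧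
    (G.blowUp.IsDisjointUnionOfCliques ∨ G.blowUp.IsCompleteMultipartite) := by
  have h := Template.loopAdj_trans_or_of_not_isUniform hG
  exact ⟨fun hr => h.imp hr.of_loopAdj_trans hr.of_loopAdj_not_trans,
    h.imp Template.isDisjointUnionOfCliques_blowUp Template.isCompleteMultipartite_blowUp⟩
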